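/- Let $\Bbbk$ be a field of characteristic zero and let $W_+$ be the positive Witt algebra, that is, the Lie algebra over $\Bbbk$ with basis $\{e_n : n \in \mathbb{Z}_{\ge 1}\}$ and Lie bracket $[e_i, e_j] = (j-i)e_{i+j}$. Let $\mathrm{U}(W_+)$ be its universal enveloping algebra with the order filtration, where $U_n$ is the span of all products of at most $n$ elements of $W_+$ and $U_{-1} = 0$, and identify the associated graded ring of this filtration with the symmetric algebra $\mathrm{S}(W_+)$ in the canonical way. For a two-sided ideal $J$ of $\mathrm{U}(W_+)$ let $$\operatorname{gr} J = \bigoplus_{n \ge 0} \bigl((J \cap U_n) + U_{n-1}\bigr)/U_{n-1} \subseteq \mathrm{S}(W_+)$$ be its associated graded ideal. Then $\mathrm{U}(W_+)$ satisfies the ascending chain condition on two-sided ideals whose associated graded ideals are radical: if $J_0 \subseteq J_1 \subseteq J_2 \subseteq \cdots$ are two-sided ideals of $\mathrm{U}(W_+)$ such that $\operatorname{gr} J_n$ is a radical ideal of $\mathrm{S}(W_+)$ for every $n \ge 0$, then there is an $N$ with $J_n = J_N$ for all $n \ge N$. -/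

import Mathlib

/-- The underlying vector space of the positive Witt algebra `W₊` over `k`:
it has the basis `e n`, `n ∈ ℤ_{≥ 1}`. -/
def PositiveWitt (k : Type*) [Field k] : Type _ := ℕ+ →₀ k

namespace PositiveWitt

noncomputable section

variable {k : Type*} [Field k]

instance : AddCommGroup (PositiveWitt k) := inferInstanceAs (AddCommGroup (ℕ+ →₀ k))

instance : Module k (PositiveWitt k) := inferInstanceAs (Module k (ℕ+ →₀ k))

variable (k) in
/-- The standard basis of `W₊`. -/
def basis : Module.Basis ℕ+ k (PositiveWitt k) := Module.Basis.ofRepr (LinearEquiv.refl k (ℕ+ →₀ k))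

variable (k) in
/-- The basis vector `e n`. -/
def e (n : ℕ+) : PositiveWitt k := basis k n

variable (k) in
/-- The bilinear extension of `[e i, e j] = (j - i) e (i + j)`. -/
def bracketBilin : PositiveWitt k →ₗ[k] PositiveWitt k →ₗ[k] PositiveWitt k :=
  (basis k).constr k fun i => (basis k).constr k fun j =>
    (((j : ℕ) : k) - ((i : ℕ) : k)) • e k (i + j)

instance : Bracket (PositiveWitt k) (PositiveWitt k) := ⟨fun x y => bracketBilin k x y⟩

theorem bracket_def (x y : PositiveWitt k) : ⁅x, y⁆ = bracketBilin k x y := rfl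

theorem bracketBilin_e_e (i j : ℕ+) :
    bracketBilin k (e k i) (e k j) = (((j : ℕ) : k) - ((i : ℕ) : k)) • e k (i + j) := by
  simp [bracketBilin, e]

theorem lie_e_e (i j : ℕ+) :
    ⁅e k i, e k j⁆ = (((j : ℕ) : k) - ((i : ℕ) : k)) • e k (i + j) :=
  bracketBilin_e_e i j

theorem bracketBilin_swap (x y : PositiveWitt k) :
    bracketBilin k x y = - bracketBilin k y x := by
  have h : bracketBilin k = - (bracketBilin k).flip := by
    refine (basis k).ext fun i => (basis k).ext fun j => ?_
    change bracketBilin k (e k i) (e k j) = - bracketBilin k (e k j) (e k i)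
    rw [bracketBilin_e_e, bracketBilin_e_e, add_comm j i, ← neg_smul, neg_sub]
  exact congrArg (fun B => B x y) h

theorem bracketBilin_leibniz (x y z : PositiveWitt k) :
    bracketBilin k x (bracketBilin k y z) =
      bracketBilin k (bracketBilin k x y) z + bracketBilin k y (bracketBilin k x z) := by
  let B := bracketBilin k
  have key : ∀ i j l : ℕ+, B (e k i) (B (e k j) (e k l)) =
      B (B (e k i) (e k j)) (e k l) + B (e k j) (B (e k i) (e k l)) := by
    intro i j l
    simp only [B, bracketBilin_e_e, map_smul, LinearMap.smul_apply, smul_smul]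
    rw [← add_assoc i j l, show j + (i + l) = i + j + l by rw [← add_assoc, add_comm j i],
      ← add_smul]
    congr 1
    push_cast
    ring
  have h1 : ∀ (i j : ℕ+) (z : PositiveWitt k), B (e k i) (B (e k j) z) =
      B (B (e k i) (e k j)) z + B (e k j) (B (e k i) z) := by
    intro i j z
    have h : (B (e k i)) ∘ₗ (B (e k j)) =
        B (B (e k i) (e k j)) + (B (e k j)) ∘ₗ (B (e k i)) :=
      (basis k).ext fun l => key i j l
    exact LinearMap.congr_fun h z
  have h2 : ∀ (i : ℕ+) (y z : PositiveWitt k), B (e k i) (B y z) =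
      B (B (e k i) y) z + B y (B (e k i) z) := by
    intro i y z
    have h : (B (e k i)) ∘ₗ (B.flip z) =
        (B.flip z) ∘ₗ (B (e k i)) + B.flip (B (e k i) z) :=
      (basis k).ext fun j => h1 i j z
    exact LinearMap.congr_fun h y
  have h : B.flip (B y z) = (B.flip z) ∘ₗ (B.flip y) + (B y) ∘ₗ (B.flip z) :=
    (basis k).ext fun i => h2 i y z
  exact LinearMap.congr_fun h x

variable [CharZero k]

instance : LieRing (PositiveWitt k) where
  add_lie x y z := by simp [bracket_def]
  lie_add x y z := by simp [bracket_def]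
  lie_self x := by
    have h : bracketBilin k x x = - bracketBilin k x x := bracketBilin_swap x x
    have h2 : (2 : k) • bracketBilin k x x = 0 := by
      rw [two_smul]; nth_rewrite 1 [h]; simp
    exact (smul_eq_zero.mp h2).resolve_left two_ne_zero
  leibniz_lie x y z := bracketBilin_leibniz x y z

instance : LieAlgebra k (PositiveWitt k) where
  lie_smul t x y := by simp [bracket_def]

end

end PositiveWitt

namespace UniversalEnvelopingAlgebra

noncomputable section

variable (R : Type*) (L : Type*) [CommRing R] [LieRing L] [LieAlgebra R L]

/-- The step `U_{< n}` of the order filtration of `U(L)`: the span of all products of fewer than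
`n` elements of `L`. For `n ≥ 1` it is `U_{n - 1}`, and `U_{< 0} = 0`. -/
def orderLT (n : ℕ) : Submodule R (UniversalEnvelopingAlgebra R L) :=
  ⨆ i : Fin n, LinearMap.range ((mkAlgHom R L).toLinearMap ∘ₗ TensorAlgebra.ι R) ^ (i : ℕ)

/-- `f ∈ S(L)` is the `n`-th symbol of `u ∈ U_n`, that is, `f` is homogeneous of degree `n` and
corresponds to the class of `u` in `U_n / U_{n - 1}` under the canonical map
`Sⁿ(L) → U_n / U_{n - 1}`, `x₁ ⋯ xₙ ↦ [x₁ ⋯ xₙ]`. The map is described through the homogeneous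
part `Tⁿ(L)` of the tensor algebra, which surjects onto `Sⁿ(L)` and onto `U_n / U_{n - 1}`. -/
def IsSymbol (n : ℕ) (u : UniversalEnvelopingAlgebra R L) (f : SymmetricAlgebra R L) : Prop :=
  ∃ t ∈ LinearMap.range (TensorAlgebra.ι R : L →ₗ[R] TensorAlgebra R L) ^ n,
    u - mkAlgHom R L t ∈ orderLT R L n ∧ SymmetricAlgebra.algHom R L t = f

variable {R L}

/-- The associated graded ideal `gr J = ⨁ₙ (J ∩ U_n + U_{n - 1}) / U_{n - 1}` of a two-sided ideal
`J` of `U(L)` for the order filtration, as an ideal of `S(L) = gr U(L)`: it is spanned by the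
symbols of the elements of `J`. -/
def grIdeal (J : TwoSidedIdeal (UniversalEnvelopingAlgebra R L)) :
    Ideal (SymmetricAlgebra R L) :=
  Ideal.span {f | ∃ n : ℕ, ∃ u ∈ J, IsSymbol R L n u f}

end

end UniversalEnvelopingAlgebra

/-!
The Poisson bracket `D = {e₁, ·}` preserves the ideal `gr J`, and `D^n e₂ = n! e_{n+2}`, so in
characteristic zero `(S(W₊), D)` is the ring of differential polynomials in `e₂` over the Noetherian
ring of constants `k[e₁]`. The Ritt–Raudenbush basis theorem gives the ascending chain condition on
its radical differential ideals. As the order filtration is exhaustive, `J ↦ gr J` is strictly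
monotone, so the chain condition descends to `U(W₊)`.

For Ritt–Raudenbush, the radical differential ideals form a frame in which the compact elements are
the finitely generated ideals. If some ideal were not compact, there would be a maximal such ideal
`P`; it is prime. Ritt's reduction then provides `a ∉ P` and a compact `F ≤ P` with `a P ⊆ F`, while
maximality of `P` excludes this.
-/

section MaximalNoncompact

variable {α : Type*}

theorem exists_maximal_not_isCompactElement [CompleteLattice α]
    (h : ∃ a : α, ¬ IsCompactElement a) : ∃ P : α, Maximal (fun a => ¬ IsCompactElement a) P := by
  obtain ⟨a, ha⟩ := h
  have hbdd : ∀ c ⊆ {a : α | ¬ IsCompactElement a}, IsChain (· ≤ ·) c → c.Nonempty →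
      ¬ IsCompactElement (sSup c) := by
    intro c hc hchain hne hcompact
    obtain ⟨x, hx, hle⟩ :=
      (CompleteLattice.isCompactElement_iff_le_of_directed_sSup_le α _).1 hcompact c hne
        hchain.directedOn le_rfl
    rw [le_antisymm hle (le_sSup hx)] at hcompact
    exact hc hx hcompact
  obtain ⟨P, -, hP⟩ := zorn_le_nonempty₀ {a : α | ¬ IsCompactElement a}
    (fun c hc hchain y hy => ⟨sSup c, hbdd c hc hchain ⟨y, hy⟩, fun _ => le_sSup⟩) a ha
  exact ⟨P, hP⟩

theorem isCompactElement_sup [CompleteLattice α] {a b : α} (ha : IsCompactElement a)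
    (hb : IsCompactElement b) : IsCompactElement (a ⊔ b) := by
  classical
  simpa using CompleteLattice.isCompactElement_finsetSup (f := id) {a, b} (by simp [ha, hb])

theorem exists_isCompactElement_le_sup_of_maximal [CompleteLattice α] [IsCompactlyGenerated α]
    {P a : α} (hP : Maximal (fun a : α => ¬ IsCompactElement a) P) (ha : ¬ a ≤ P) :
    ∃ F ≤ P, IsCompactElement F ∧ P ≤ F ⊔ a := by
  classical
  have hcompact : IsCompactElement (P ⊔ a) := by
    by_contra h
    exact ha (le_sup_right.trans (hP.2 h le_sup_left))
  obtain ⟨t, ht, hle⟩ :=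
    (CompleteLattice.isCompactElement_iff_exists_le_sSup_of_le_sSup α _).1 hcompact
      (insert a {c | IsCompactElement c ∧ c ≤ P})
      (by rw [sSup_insert, sSup_compact_le_eq, sup_comm])
  have hmem : ∀ c ∈ t.erase a, IsCompactElement c ∧ c ≤ P := fun c hc =>
    (ht (Finset.mem_of_mem_erase hc)).resolve_left (Finset.ne_of_mem_erase hc)
  refine ⟨(t.erase a).sup id, Finset.sup_le fun c hc => (hmem c hc).2,
    CompleteLattice.isCompactElement_finsetSup _ fun c hc => (hmem c hc).1,
    le_sup_left.trans (hle.trans ?_)⟩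
  rw [sup_comm, ← id_eq a, ← Finset.sup_insert, id_eq]
  exact Finset.sup_mono (Finset.insert_erase_subset a t)

variable [Order.Frame α] [IsCompactlyGenerated α] {P : α}

theorem not_inf_le_isCompactElement_of_maximal
    (hP : Maximal (fun a : α => ¬ IsCompactElement a) P) {a F : α} (ha : ¬ a ≤ P)
    (hF : IsCompactElement F) (hFP : F ≤ P) : ¬ a ⊓ P ≤ F := by
  intro hle
  obtain ⟨G, hGP, hG, hPG⟩ := exists_isCompactElement_le_sup_of_maximal hP ha
  have hPFG : P ≤ F ⊔ G := calc
    P ≤ (G ⊔ a) ⊓ P := le_inf hPG le_rfl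
    _ = (G ⊓ P) ⊔ (a ⊓ P) := inf_sup_right ..
    _ ≤ F ⊔ G := sup_le (inf_le_left.trans le_sup_right) (hle.trans le_sup_left)
  rw [le_antisymm hPFG (sup_le hFP hGP)] at hP
  exact hP.1 (isCompactElement_sup hF hG)

theorem le_or_le_of_inf_le_of_maximal
    (hP : Maximal (fun a : α => ¬ IsCompactElement a) P) {a b : α}
    (hab : IsCompactElement (a ⊓ b)) (hle : a ⊓ b ≤ P) : a ≤ P ∨ b ≤ P := by
  by_contra! h
  obtain ⟨F, hFP, hF, hPF⟩ := exists_isCompactElement_le_sup_of_maximal hP h.1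
  refine not_inf_le_isCompactElement_of_maximal hP h.2 (isCompactElement_sup hF hab)
    (sup_le hFP hle) ?_
  calc b ⊓ P ≤ b ⊓ (F ⊔ a) := inf_le_inf_left b hPF
    _ = (b ⊓ F) ⊔ (b ⊓ a) := inf_sup_left ..
    _ ≤ F ⊔ (a ⊓ b) := sup_le_sup inf_le_right (inf_comm b a).le

end MaximalNoncompact

/-- A radical differential ideal of the differential ring `(R, D)`: a radical ideal which is stable
under `D`. The ascending chain condition on these ideals is the conclusion of the Ritt–Raudenbush
theorem. -/
structure RadicalDifferentialIdeal {k R : Type*} [CommSemiring k] [CommRing R] [Algebra k R]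
    (D : Derivation k R R) where
  toIdeal : Ideal R
  isRadical : toIdeal.IsRadical
  map_mem {x : R} : x ∈ toIdeal → D x ∈ toIdeal

namespace RadicalDifferentialIdeal

variable {k R : Type*} [CommSemiring k] [CommRing R] [Algebra k R] {D : Derivation k R R}

instance : SetLike (RadicalDifferentialIdeal D) R where
  coe I := I.toIdeal
  coe_injective := by
    rintro ⟨I, _, _⟩ ⟨J, _, _⟩ h
    congr
    exact SetLike.coe_injective h

instance : PartialOrder (RadicalDifferentialIdeal D) := .ofSetLike (RadicalDifferentialIdeal D) R

theorem mem_toIdeal {I : RadicalDifferentialIdeal D} {x : R} : x ∈ I.toIdeal ↔ x ∈ I := Iff.rfl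

theorem mem_of_pow_mem {I : RadicalDifferentialIdeal D} {x : R} {n : ℕ} (h : x ^ n ∈ I) : x ∈ I :=
  I.isRadical ⟨n, h⟩

theorem iterate_mem {I : RadicalDifferentialIdeal D} {x : R} (hx : x ∈ I) (n : ℕ) :
    D^[n] x ∈ I := by
  induction n with
  | zero => exact hx
  | succ n ih => exact Function.iterate_succ_apply' D n x ▸ I.map_mem ih

instance : InfSet (RadicalDifferentialIdeal D) where
  sInf S :=
    { toIdeal := ⨅ I : S, I.1.toIdeal
      isRadical := Ideal.isRadical_iInf _ fun I => I.1.isRadical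
      map_mem := by
        simp only [Submodule.mem_iInf]
        exact fun hx I => I.1.map_mem (hx I) }

theorem mem_sInf {S : Set (RadicalDifferentialIdeal D)} {x : R} :
    x ∈ sInf S ↔ ∀ I ∈ S, x ∈ I := by
  change x ∈ ⨅ I : S, I.1.toIdeal ↔ _
  simp only [Submodule.mem_iInf, Subtype.forall, mem_toIdeal]

instance : CompleteLattice (RadicalDifferentialIdeal D) :=
  completeLatticeOfInf _ fun _ =>
    ⟨fun _ hI _ hx => mem_sInf.1 hx _ hI, fun _ hJ _ hx => mem_sInf.2 fun _ hI => hJ hI hx⟩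

variable (D) in
/-- The radical differential ideal `{s}` generated by a set `s`. -/
def span (s : Set R) : RadicalDifferentialIdeal D := sInf {I | s ⊆ I}

theorem span_le {s : Set R} {I : RadicalDifferentialIdeal D} : span D s ≤ I ↔ s ⊆ I :=
  ⟨fun h _ hx => h (mem_sInf.2 fun _ hJ => hJ hx), fun h => sInf_le h⟩

theorem subset_span {s : Set R} : s ⊆ span D s := span_le.1 le_rfl

theorem mem_span_singleton_self (x : R) : x ∈ span D {x} := subset_span rfl

theorem span_singleton_le {x : R} {I : RadicalDifferentialIdeal D} : span D {x} ≤ I ↔ x ∈ I :=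
  span_le.trans Set.singleton_subset_iff

theorem derivation_mul_mem {I : RadicalDifferentialIdeal D} {x y : R} (h : x * y ∈ I) :
    D x * y ∈ I := by
  have hD : x * D y + y * D x ∈ I.toIdeal := by simpa using I.map_mem h
  refine mem_of_pow_mem (n := 2) ?_
  have key : (D x * y) ^ 2 = (D x * y) * (x * D y + y * D x) - (D x * D y) * (x * y) := by ring
  exact key ▸ I.toIdeal.sub_mem (I.toIdeal.mul_mem_left _ hD) (I.toIdeal.mul_mem_left _ h)

/-- The quotient ideal `(I : s)`. It is again a radical differential ideal, which makes the radical
differential ideals a frame. -/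
def colon (I : RadicalDifferentialIdeal D) (s : Set R) : RadicalDifferentialIdeal D where
  toIdeal := I.toIdeal.colon s
  isRadical := by
    rintro x ⟨n, hx⟩
    refine Submodule.mem_colon.2 fun y hy => mem_of_pow_mem (n := n + 1) ?_
    have key : (x * y) ^ (n + 1) = (x * y ^ n) * (x ^ n * y) := by ring
    exact key ▸ I.toIdeal.mul_mem_left _ (Submodule.mem_colon.1 hx y hy)
  map_mem hx := Submodule.mem_colon.2 fun y hy =>
    derivation_mul_mem (Submodule.mem_colon.1 hx y hy)

theorem mem_colon {I : RadicalDifferentialIdeal D} {s : Set R} {x : R} :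
    x ∈ I.colon s ↔ ∀ y ∈ s, x * y ∈ I :=
  Submodule.mem_colon

theorem mul_mem_of_inf_le {I J K : RadicalDifferentialIdeal D} (h : I ⊓ J ≤ K) {x y : R}
    (hx : x ∈ I) (hy : y ∈ J) : x * y ∈ K := by
  refine h (mem_sInf.2 ?_)
  rintro _ (rfl | rfl)
  exacts [Ideal.mul_mem_right y _ hx, Ideal.mul_mem_left _ x hy]

theorem inf_le_of_le_colon {I J K : RadicalDifferentialIdeal D} (h : I ≤ K.colon J) :
    I ⊓ J ≤ K := fun x hx =>
  mem_of_pow_mem (n := 2) <| sq x ▸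
    mem_colon.1 (h (inf_le_left (b := J) hx)) x (inf_le_right (a := I) hx)

instance : Order.Frame (RadicalDifferentialIdeal D) :=
  .ofMinimalAxioms
    { inf_sSup_le_iSup_inf := fun I S => by
        rw [inf_comm]
        refine inf_le_of_le_colon (sSup_le fun J hJ x hx => mem_colon.2 fun y hy => ?_)
        rw [mul_comm]
        exact mul_mem_of_inf_le (le_iSup₂_of_le J hJ le_rfl) hy hx }

theorem span_inf_span_le {s t : Set R} {K : RadicalDifferentialIdeal D}
    (h : ∀ x ∈ s, ∀ y ∈ t, x * y ∈ K) : span D s ⊓ span D t ≤ K := by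
  have hs : ∀ y ∈ t, span D s ≤ K.colon {y} := fun y hy =>
    span_le.2 fun x hx => mem_colon.2 fun _ hz => hz ▸ h x hx y hy
  refine inf_le_of_le_colon fun x hx => mem_colon.2 fun y hy => ?_
  have ht : span D t ≤ K.colon {x} := span_le.2 fun y hy =>
    mem_colon.2 fun _ hz => hz ▸ mul_comm x y ▸ mem_colon.1 (hs y hy hx) y rfl
  exact mul_comm y x ▸ mem_colon.1 (ht hy) x rfl

theorem span_singleton_inf_span_singleton (x y : R) :
    span D {x} ⊓ span D {y} = span D {x * y} := by
  refine le_antisymm (span_inf_span_le ?_) (span_singleton_le.2 ?_)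
  · rintro _ rfl _ rfl
    exact mem_span_singleton_self _
  · exact mul_mem_of_inf_le le_rfl (mem_span_singleton_self x) (mem_span_singleton_self y)

theorem mem_sSup_of_directedOn {S : Set (RadicalDifferentialIdeal D)} (hne : S.Nonempty)
    (hS : DirectedOn (· ≤ ·) S) {x : R} (hx : x ∈ sSup S) : ∃ I ∈ S, x ∈ I := by
  have hmem {y : R} : y ∈ sSup (toIdeal '' S) ↔ ∃ I ∈ S, y ∈ I := by
    rw [Submodule.mem_sSup_of_directed (hne.image _) (hS.mono_comp fun _ _ h => h),
      Set.exists_mem_image]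
    rfl
  let U : RadicalDifferentialIdeal D :=
    { toIdeal := sSup (toIdeal '' S)
      isRadical := fun y ⟨n, hy⟩ =>
        let ⟨I, hI, h⟩ := hmem.1 hy
        hmem.2 ⟨I, hI, mem_of_pow_mem h⟩
      map_mem := fun hy =>
        let ⟨I, hI, h⟩ := hmem.1 hy
        hmem.2 ⟨I, hI, I.map_mem h⟩ }
  have hU : sSup S ≤ U := sSup_le fun I hI y hy => hmem.2 ⟨I, hI, hy⟩
  exact hmem.1 (hU hx)

theorem isCompactElement_span_singleton (x : R) : IsCompactElement (span D {x}) := by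
  rw [CompleteLattice.isCompactElement_iff_le_of_directed_sSup_le]
  intro S hne hS h
  obtain ⟨I, hI, hx⟩ := mem_sSup_of_directedOn hne hS (span_singleton_le.1 h)
  exact ⟨I, hI, span_singleton_le.2 hx⟩

instance : IsCompactlyGenerated (RadicalDifferentialIdeal D) where
  exists_sSup_eq I := by
    refine ⟨(fun x => span D {x}) '' I, ?_, le_antisymm (sSup_le ?_) fun x hx =>
      span_singleton_le.1 (le_sSup (Set.mem_image_of_mem _ hx))⟩
    · rintro _ ⟨x, -, rfl⟩
      exact isCompactElement_span_singleton x
    · rintro _ ⟨x, hx, rfl⟩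
      exact span_singleton_le.2 hx

/-- The contraction of a radical differential ideal along a homomorphism of differential rings. -/
def comap {l A : Type*} [CommSemiring l] [CommRing A] [Algebra l A] {d : Derivation l A A}
    (f : A →+* R) (hf : ∀ a, D (f a) = f (d a)) (I : RadicalDifferentialIdeal D) :
    RadicalDifferentialIdeal d where
  toIdeal := I.toIdeal.comap f
  isRadical := I.isRadical.comap f
  map_mem {a} ha := Ideal.mem_comap.2 (hf a ▸ I.map_mem ha)

instance [IsNoetherianRing R] : WellFoundedGT (RadicalDifferentialIdeal D) :=
  StrictMono.wellFoundedGT (β := Ideal R) (f := toIdeal) fun _ _ h => h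

end RadicalDifferentialIdeal

section PolynomialRelations

open Polynomial

theorem exists_leadingCoeff_pow_mul_eq_mul_add {B : Type*} [CommRing B] {p : B[X]}
    (hp : 0 < p.natDegree) (q : B[X]) :
    ∃ (N : ℕ) (a r : B[X]), C p.leadingCoeff ^ N * q = p * a + r ∧ r.natDegree < p.natDegree := by
  induction hd : q.natDegree using Nat.strong_induction_on generalizing q with
  | h d ih =>
    rcases lt_or_ge q.natDegree p.natDegree with hlt | hle
    · exact ⟨0, 0, q, by ring, hlt⟩
    · obtain ⟨N, a, r, h, hr⟩ := ih _
        (hd ▸ natDegree_cancelLeads_lt_of_natDegree_le_natDegree hle (hp.trans_le hle)) _ rfl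
      rw [cancelLeads, Nat.sub_eq_zero_of_le hle] at h
      refine ⟨N + 1,
        a + C p.leadingCoeff ^ N * C q.leadingCoeff * X ^ (q.natDegree - p.natDegree), r, ?_, hr⟩
      linear_combination h

theorem exists_minimal_aeval_mem {B R : Type*} [CommRing B] [CommRing R] [Algebra B R]
    [Algebra ℚ R] {P : Ideal R} {y : R}
    (h : ∃ p : B[X], aeval y p ∈ P ∧ ∃ i, algebraMap B R (p.coeff i) ∉ P) :
    ∃ p : B[X], aeval y p ∈ P ∧ algebraMap B R p.leadingCoeff ∉ P ∧ aeval y p.derivative ∉ P ∧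
      ∀ q : B[X], q.natDegree < p.natDegree → aeval y q ∈ P →
        ∀ i, algebraMap B R (q.coeff i) ∈ P := by
  obtain ⟨p, ⟨hpP, i, hi⟩, hmin⟩ := exists_minimalFor_of_wellFoundedLT _ natDegree h
  have hlow : ∀ q : B[X], q.natDegree < p.natDegree → aeval y q ∈ P →
      ∀ i, algebraMap B R (q.coeff i) ∈ P := fun q hq hqP i => by
    by_contra hi
    exact hq.not_ge (hmin ⟨hqP, i, hi⟩ hq.le)
  have hlead : algebraMap B R p.leadingCoeff ∉ P := fun hlc => by
    have hi' : i ≠ p.natDegree := fun h => hi (h ▸ hlc)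
    have herase : aeval y p.eraseLead ∈ P := by
      rw [← self_sub_C_mul_X_pow, map_sub, map_mul, aeval_C]
      exact P.sub_mem hpP (P.mul_mem_right _ hlc)
    rw [← eraseLead_coeff_of_ne i hi'] at hi
    rcases eraseLead_natDegree_lt_or_eraseLead_eq_zero p with hlt | hzero
    · exact hi (hlow _ hlt herase i)
    · exact hi (by simp [hzero])
  refine ⟨p, hpP, hlead, fun hderiv => hlead ?_, hlow⟩
  have hdeg : p.natDegree ≠ 0 := fun h0 => hlead <| by
    rwa [eq_C_of_natDegree_eq_zero h0, aeval_C, ← h0] at hpP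
  have hcoeff := hlow _ (natDegree_derivative_lt hdeg) hderiv (p.natDegree - 1)
  rw [coeff_derivative, Nat.sub_add_cancel (Nat.pos_of_ne_zero hdeg), ← Nat.cast_add_one,
    Nat.sub_add_cancel (Nat.pos_of_ne_zero hdeg), map_mul, map_natCast] at hcoeff
  have hunit : IsUnit (p.natDegree : R) := by
    simpa using (Nat.cast_ne_zero.2 hdeg : (p.natDegree : ℚ) ≠ 0).isUnit.map (algebraMap ℚ R)
  exact (P.mul_unit_mem_iff_mem hunit).1 hcoeff

end PolynomialRelations

section AdjoinLT

open Polynomial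

variable {A R : Type*} [CommRing A] [CommRing R] [Algebra A R]

variable (A) in
/-- The subalgebra `A[y 0, …, y (n - 1)]`. When `y i` is the `i`-th derivative of a differential
indeterminate, it consists of the differential polynomials of order less than `n`. -/
def adjoinLT (y : ℕ → R) (n : ℕ) : Subalgebra A R := Algebra.adjoin A (y '' Set.Iio n)

variable {y : ℕ → R}

theorem adjoinLT_mono {m n : ℕ} (h : m ≤ n) : adjoinLT A y m ≤ adjoinLT A y n :=
  Algebra.adjoin_mono (Set.image_mono (Set.Iio_subset_Iio h))

theorem gen_mem_adjoinLT {i n : ℕ} (h : i < n) : y i ∈ adjoinLT A y n :=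
  Algebra.subset_adjoin ⟨i, h, rfl⟩

theorem exists_mem_adjoinLT (hgen : Algebra.adjoin A (Set.range y) = ⊤) (x : R) :
    ∃ n, x ∈ adjoinLT A y n := by
  have hdir : Directed (· ≤ ·) (adjoinLT A y) := Monotone.directed_le fun _ _ => adjoinLT_mono
  have hle : Algebra.adjoin A (Set.range y) ≤ ⨆ n, adjoinLT A y n := Algebra.adjoin_le <|
    Set.range_subset_iff.2 fun i =>
      le_iSup (adjoinLT A y) (i + 1) (gen_mem_adjoinLT i.lt_succ_self)
  have hx : x ∈ ((⨆ n, adjoinLT A y n : Subalgebra A R) : Set R) := hle (hgen ▸ Algebra.mem_top)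
  rwa [Subalgebra.coe_iSup_of_directed hdir, Set.mem_iUnion] at hx

theorem aeval_mem_adjoinLT_succ {n : ℕ} (q : (adjoinLT A y n)[X]) :
    aeval (y n) q ∈ adjoinLT A y (n + 1) := by
  rw [aeval_eq_sum_range]
  exact sum_mem fun i _ => mul_mem (adjoinLT_mono n.le_succ (q.coeff i).2)
    (pow_mem (gen_mem_adjoinLT n.lt_succ_self) i)

theorem exists_aeval_eq_of_mem_adjoinLT_succ {n : ℕ} {x : R} (hx : x ∈ adjoinLT A y (n + 1)) :
    ∃ q : (adjoinLT A y n)[X], aeval (y n) q = x := by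
  suffices adjoinLT A y (n + 1) ≤ (aeval (R := adjoinLT A y n) (y n)).range.restrictScalars A from
    this hx
  refine Algebra.adjoin_le ?_
  rintro _ ⟨i, hi, rfl⟩
  rcases (Nat.lt_succ_iff.1 hi).lt_or_eq with hlt | rfl
  · exact ⟨C ⟨y i, gen_mem_adjoinLT hlt⟩, aeval_C ..⟩
  · exact ⟨X, aeval_X _⟩

section Derivation

variable {k : Type*} [CommRing k] [Algebra k A] [Algebra k R] {d : Derivation k A A}
  {D : Derivation k R R}

theorem derivation_mem_adjoinLT_succ (hd : ∀ a, D (algebraMap A R a) = algebraMap A R (d a))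
    (hy : ∀ n, D (y n) = y (n + 1)) {n : ℕ} {x : R} (hx : x ∈ adjoinLT A y n) :
    D x ∈ adjoinLT A y (n + 1) := by
  induction hx using Algebra.adjoin_induction with
  | mem x hx =>
    obtain ⟨i, hi, rfl⟩ := hx
    exact hy i ▸ gen_mem_adjoinLT (Nat.succ_lt_succ hi)
  | algebraMap a => exact hd a ▸ Subalgebra.algebraMap_mem _ _
  | add a b _ _ ha hb => exact map_add D a b ▸ add_mem ha hb
  | mul a b ha hb hDa hDb =>
    rw [D.leibniz]
    exact add_mem (mul_mem (adjoinLT_mono n.le_succ ha) hDb)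
      (mul_mem (adjoinLT_mono n.le_succ hb) hDa)

theorem derivation_aeval_sub_mem_adjoinLT_succ
    (hd : ∀ a, D (algebraMap A R a) = algebraMap A R (d a)) (hy : ∀ n, D (y n) = y (n + 1))
    {n : ℕ} (p : (adjoinLT A y n)[X]) :
    D (aeval (y n) p) - aeval (y n) p.derivative * y (n + 1) ∈ adjoinLT A y (n + 1) := by
  induction p using Polynomial.induction_on' with
  | add p q hp hq =>
    convert add_mem hp hq using 1
    simp only [map_add]
    ring
  | monomial i c =>
    have key : D (aeval (y n) (monomial i c)) -
        aeval (y n) (derivative (monomial i c)) * y (n + 1) = D c * y n ^ i := by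
      simp only [aeval_monomial, derivative_monomial, D.leibniz, D.leibniz_pow, hy, map_mul,
        map_natCast, nsmul_eq_mul, smul_eq_mul, Subalgebra.algebraMap_def,
        Algebra.algebraMap_self_apply]
      ring
    rw [key]
    exact mul_mem (derivation_mem_adjoinLT_succ hd hy c.2)
      (pow_mem (gen_mem_adjoinLT n.lt_succ_self) i)

theorem iterate_derivation_sub_mem_adjoinLT
    (hd : ∀ a, D (algebraMap A R a) = algebraMap A R (d a)) (hy : ∀ n, D (y n) = y (n + 1))
    {n : ℕ} {f s : R} (hs : s ∈ adjoinLT A y (n + 1))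
    (hf : D f - s * y (n + 1) ∈ adjoinLT A y (n + 1)) (m : ℕ) :
    D^[m + 1] f - s * y (n + 1 + m) ∈ adjoinLT A y (n + 1 + m) := by
  induction m with
  | zero => exact hf
  | succ m ih =>
    have hDs : D s ∈ adjoinLT A y (n + 1 + m + 1) :=
      adjoinLT_mono (by lia) (derivation_mem_adjoinLT_succ hd hy hs)
    have key : D^[m + 2] f - s * y (n + 1 + m + 1) =
        D (D^[m + 1] f - s * y (n + 1 + m)) + y (n + 1 + m) * D s := by
      rw [Function.iterate_succ_apply', map_sub, D.leibniz, hy, smul_eq_mul, smul_eq_mul]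
      ring
    rw [← add_assoc, key]
    exact add_mem (derivation_mem_adjoinLT_succ hd hy ih)
      (mul_mem (gen_mem_adjoinLT (Nat.lt_succ_self _)) hDs)

end Derivation

theorem exists_sub_pow_mul_mem_of_sub_mul_mem (hgen : Algebra.adjoin A (Set.range y) = ⊤)
    {B : Ideal R} {n : ℕ} {s : R} (hs : s ∈ adjoinLT A y n)
    (h : ∀ m, ∃ r ∈ adjoinLT A y (n + m), r - s * y (n + m) ∈ B) (x : R) :
    ∃ N, ∃ r ∈ adjoinLT A y n, r - s ^ N * x ∈ B := by
  let V : Subalgebra A (R ⧸ B) := (adjoinLT A y n).map (Ideal.Quotient.mkₐ A B)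
  have hsV : Submonoid.powers (Ideal.Quotient.mk B s) ≤ V.toSubmonoid :=
    Submonoid.powers_le.2 ⟨s, hs, rfl⟩
  let T : Subalgebra A R := (V.saturation _ hsV).comap (Ideal.Quotient.mkₐ A B)
  have hT {x : R} : x ∈ T ↔ ∃ N, ∃ r ∈ adjoinLT A y n, r - s ^ N * x ∈ B := by
    simp only [T, V, Subalgebra.mem_comap, Subalgebra.mem_saturation_iff, Submonoid.mem_powers_iff,
      Subalgebra.mem_map, Ideal.Quotient.mkₐ_eq_mk, exists_exists_eq_and, smul_eq_mul, ← map_pow,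
      ← map_mul, Ideal.Quotient.mk_eq_mk_iff_sub_mem]
  have hgenT (i : ℕ) : y i ∈ T := by
    induction i using Nat.strong_induction_on with
    | h i ih =>
      rcases lt_or_ge i n with hlt | hle
      · exact hT.2 ⟨0, y i, gen_mem_adjoinLT hlt, by simp⟩
      · obtain ⟨m, rfl⟩ := Nat.exists_eq_add_of_le hle
        obtain ⟨r, hr, hrB⟩ := h m
        have hsub : adjoinLT A y (n + m) ≤ T := Algebra.adjoin_le <| by
          rintro _ ⟨j, hj, rfl⟩
          exact ih j hj
        obtain ⟨N, t, ht, htB⟩ := hT.1 (hsub hr)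
        refine hT.2 ⟨N + 1, t, ht, ?_⟩
        have key : t - s ^ (N + 1) * y (n + m) =
            s ^ N * (r - s * y (n + m)) + (t - s ^ N * r) := by ring
        exact key ▸ B.add_mem (B.mul_mem_left _ hrB) htB
  refine hT.1 ((?_ : Algebra.adjoin A (Set.range y) ≤ T) (hgen ▸ Algebra.mem_top))
  exact Algebra.adjoin_le (Set.range_subset_iff.2 hgenT)

end AdjoinLT

namespace RadicalDifferentialIdeal

section RittRaudenbush

open Polynomial

variable {k A R : Type*} [CommRing k] [CommRing A] [CommRing R] [Algebra k A] [Algebra k R]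
  [Algebra A R] {d : Derivation k A A} {D : Derivation k R R} {y : ℕ → R}

theorem mul_mem_of_pow_mul_mem {I : RadicalDifferentialIdeal D} {s x : R} {N : ℕ}
    (h : s ^ N * x ∈ I) : s * x ∈ I := by
  refine mem_of_pow_mem (n := N + 1) ?_
  have key : (s * x) ^ (N + 1) = s * x ^ N * (s ^ N * x) := by ring
  exact key ▸ I.toIdeal.mul_mem_left _ h

theorem mem_or_mem_of_maximal {P : RadicalDifferentialIdeal D}
    (hP : Maximal (fun I : RadicalDifferentialIdeal D => ¬ IsCompactElement I) P) {a b : R}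
    (hab : a * b ∈ P) : a ∈ P ∨ b ∈ P := by
  simp only [← span_singleton_le (D := D)] at hab ⊢
  rw [← span_singleton_inf_span_singleton] at hab
  refine le_or_le_of_inf_le_of_maximal hP ?_ hab
  exact span_singleton_inf_span_singleton (D := D) a b ▸ isCompactElement_span_singleton _

theorem exists_sub_pow_mul_mem_of_aeval_mem (hd : ∀ a, D (algebraMap A R a) = algebraMap A R (d a))
    (hy : ∀ n, D (y n) = y (n + 1)) (hgen : Algebra.adjoin A (Set.range y) = ⊤)
    {I : RadicalDifferentialIdeal D} {n : ℕ} {p : (adjoinLT A y n)[X]} (hp : aeval (y n) p ∈ I)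
    (x : R) : ∃ N, ∃ r ∈ adjoinLT A y (n + 1), r - aeval (y n) p.derivative ^ N * x ∈ I := by
  have hs := aeval_mem_adjoinLT_succ p.derivative
  refine exists_sub_pow_mul_mem_of_sub_mul_mem hgen (B := I.toIdeal) hs (fun m => ?_) x
  refine ⟨_, neg_mem (iterate_derivation_sub_mem_adjoinLT hd hy hs
    (derivation_aeval_sub_mem_adjoinLT_succ hd hy p) m), ?_⟩
  rw [neg_sub, sub_sub_cancel_left]
  exact I.toIdeal.neg_mem (iterate_mem hp _)

theorem aeval_mem_of_coeff_mem {I : RadicalDifferentialIdeal D} {B : Type*} [CommRing B]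
    [Algebra B R] {q : B[X]} {z : R} (h : ∀ i, algebraMap B R (q.coeff i) ∈ I) :
    aeval z q ∈ I := by
  rw [aeval_eq_sum_range]
  exact I.toIdeal.sum_mem fun i _ =>
    Algebra.smul_def (q.coeff i) (z ^ i) ▸ I.toIdeal.mul_mem_right _ (h i)

theorem exists_leadingCoeff_pow_mul_aeval_mem {B : Type*} [CommRing B] [Algebra B R]
    {I P : RadicalDifferentialIdeal D} (hIP : I ≤ P) {z : R} {p : B[X]} (hdeg : 0 < p.natDegree)
    (hp : aeval z p ∈ I)
    (hmin : ∀ q : B[X], q.natDegree < p.natDegree → aeval z q ∈ P → aeval z q ∈ I) {q : B[X]}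
    (hq : aeval z q ∈ P) : ∃ M, algebraMap B R p.leadingCoeff ^ M * aeval z q ∈ I := by
  obtain ⟨M, a, t, hqt, ht⟩ := exists_leadingCoeff_pow_mul_eq_mul_add hdeg q
  have hqt' := congrArg (aeval z) hqt
  simp only [map_add, map_mul, map_pow, aeval_C] at hqt'
  have hpa : aeval z p * aeval z a ∈ I := I.toIdeal.mul_mem_right _ hp
  have htP : aeval z t ∈ P.toIdeal :=
    (Ideal.add_mem_iff_right _ (hIP hpa)).1 (hqt' ▸ P.toIdeal.mul_mem_left _ hq)
  exact ⟨M, hqt' ▸ I.toIdeal.add_mem hpa (hmin t ht htP)⟩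

/-- Ritt's reduction: modulo `f`, the separant of `f` eliminates `y i` for `i > n`, and the initial
of `f` lowers the degree in `y n` below that of `f`, where all elements of `P` are in `F`. The
multiplier `a` is the product of the initial and the separant. -/
theorem exists_mul_mem_sup_span_singleton [Algebra ℚ R]
    (hd : ∀ a, D (algebraMap A R a) = algebraMap A R (d a)) (hy : ∀ n, D (y n) = y (n + 1))
    (hgen : Algebra.adjoin A (Set.range y) = ⊤) {P F : RadicalDifferentialIdeal D} (hFP : F ≤ P)
    (hP : ∀ {a b}, a * b ∈ P → a ∈ P ∨ b ∈ P) {n : ℕ}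
    (hn : ∀ x ∈ adjoinLT A y n, x ∈ P → x ∈ F) {g : R} (hg : g ∈ adjoinLT A y (n + 1))
    (hgP : g ∈ P) (hgF : g ∉ F) : ∃ f ∈ P, ∃ a ∉ P, ∀ x ∈ P, a * x ∈ F ⊔ span D {f} := by
  have hcoeff (q : (adjoinLT A y n)[X]) (hq : ∀ i, algebraMap _ R (q.coeff i) ∈ P) :
      aeval (y n) q ∈ F := aeval_mem_of_coeff_mem fun i => hn _ (q.coeff i).2 (hq i)
  have hrel : ∃ p : (adjoinLT A y n)[X], aeval (y n) p ∈ P.toIdeal ∧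
      ∃ i, algebraMap _ R (p.coeff i) ∉ P.toIdeal := by
    obtain ⟨q, rfl⟩ := exists_aeval_eq_of_mem_adjoinLT_succ hg
    exact ⟨q, hgP, not_forall.1 fun hq => hgF (hcoeff q hq)⟩
  obtain ⟨p, hpP, hinit, hsep, hmin⟩ := exists_minimal_aeval_mem hrel
  have hdeg : 0 < p.natDegree := Nat.pos_of_ne_zero fun h0 =>
    hsep (by simp [derivative_of_natDegree_zero h0])
  let f := aeval (y n) p
  let c := algebraMap _ R p.leadingCoeff
  let s := aeval (y n) p.derivative
  have hsup : F ⊔ span D {f} ≤ P := sup_le hFP (span_singleton_le.2 hpP)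
  have hf : f ∈ F ⊔ span D {f} := span_singleton_le.1 le_sup_right
  refine ⟨f, hpP, c * s, fun hcs => (hP hcs).elim hinit hsep, fun x hx => ?_⟩
  obtain ⟨N, r, hr, hrx⟩ := exists_sub_pow_mul_mem_of_aeval_mem hd hy hgen hf x
  obtain ⟨q, rfl⟩ := exists_aeval_eq_of_mem_adjoinLT_succ hr
  have hqP : aeval (y n) q ∈ P.toIdeal :=
    (Submodule.sub_mem_iff_left _ (P.toIdeal.mul_mem_left _ hx)).1 (hsup hrx)
  obtain ⟨M, hM⟩ := exists_leadingCoeff_pow_mul_aeval_mem hsup hdeg hf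
    (fun q hq hqP => le_sup_left (b := span D {f}) (hcoeff q (hmin q hq hqP))) hqP
  have hpow : s ^ N * (c ^ M * x) ∈ (F ⊔ span D {f}).toIdeal := by
    have key : s ^ N * (c ^ M * x) =
        c ^ M * aeval (y n) q - c ^ M * (aeval (y n) q - s ^ N * x) := by ring
    exact key ▸ Ideal.sub_mem _ hM (Ideal.mul_mem_left _ _ hrx)
  have hcsx : c ^ M * (s * x) ∈ F ⊔ span D {f} := by
    rw [mul_left_comm]
    exact mul_mem_of_pow_mul_mem hpow
  rw [mul_assoc]
  exact mul_mem_of_pow_mul_mem hcsx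

variable (d) in
theorem wellFoundedGT_of_adjoin_range_eq_top [Algebra ℚ R]
    [WellFoundedGT (RadicalDifferentialIdeal d)]
    (hd : ∀ a, D (algebraMap A R a) = algebraMap A R (d a)) (hy : ∀ n, D (y n) = y (n + 1))
    (hgen : Algebra.adjoin A (Set.range y) = ⊤) : WellFoundedGT (RadicalDifferentialIdeal D) := by
  refine ((CompleteLattice.wellFoundedGT_characterisations _).out 3 0).1 ?_
  by_contra! hcompact
  obtain ⟨P, hP⟩ := exists_maximal_not_isCompactElement hcompact
  -- A compact `F ≤ P` with maximal contraction to `A` has the same contraction as `P`.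
  obtain ⟨F, ⟨hF, hFP⟩, hFmax⟩ := exists_maximalFor_of_wellFoundedGT
    (fun F : RadicalDifferentialIdeal D => IsCompactElement F ∧ F ≤ P)
    (comap (algebraMap A R) hd) ⟨span D {0},
      isCompactElement_span_singleton 0, span_singleton_le.2 P.toIdeal.zero_mem⟩
  have hzero : ∀ x ∈ adjoinLT A y 0, x ∈ P → x ∈ F := by
    intro x hx hxP
    obtain ⟨a, rfl⟩ : ∃ a, algebraMap A R a = x := by simpa [adjoinLT, Algebra.mem_bot] using hx
    have hG : F ≤ F ⊔ span D {algebraMap A R a} := le_sup_left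
    have ha : algebraMap A R a ∈ F ⊔ span D {algebraMap A R a} :=
      span_singleton_le.1 le_sup_right
    exact hFmax ⟨isCompactElement_sup hF (isCompactElement_span_singleton _),
      sup_le hFP (span_singleton_le.2 hxP)⟩ (fun _ h => hG h) ha
  obtain ⟨n, hn, hn'⟩ : ∃ n, (∀ x ∈ adjoinLT A y n, x ∈ P → x ∈ F) ∧
      ¬ ∀ x ∈ adjoinLT A y (n + 1), x ∈ P → x ∈ F := by
    by_contra! hstep
    have hPF : P ≤ F := fun x hx =>
      let ⟨n, hxn⟩ := exists_mem_adjoinLT hgen x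
      Nat.rec hzero hstep n x hxn hx
    exact hP.1 (le_antisymm hPF hFP ▸ hF)
  push Not at hn'
  obtain ⟨g, hg, hgP, hgF⟩ := hn'
  obtain ⟨f, hfP, a, haP, ha⟩ := exists_mul_mem_sup_span_singleton hd hy hgen hFP
    (mem_or_mem_of_maximal hP) hn hg hgP hgF
  refine not_inf_le_isCompactElement_of_maximal hP (span_singleton_le.not.2 haP)
    (isCompactElement_sup hF (isCompactElement_span_singleton f))
    (sup_le hFP (span_singleton_le.2 hfP)) ?_
  exact inf_le_of_le_colon (span_singleton_le.2 (mem_colon.2 ha))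

end RittRaudenbush

end RadicalDifferentialIdeal

section SymmetricDerivation

variable {R M : Type*} [CommRing R] [AddCommGroup M] [Module R M]

/-- The homomorphism `f ↦ f + ε φ(f)` into the dual numbers over the symmetric algebra, where `φ` is
extended from `M` by the Leibniz rule. -/
noncomputable def dualNumberLift (φ : M →ₗ[R] M) :
    SymmetricAlgebra R M →ₐ[R] TrivSqZeroExt (SymmetricAlgebra R M) (SymmetricAlgebra R M) :=
  SymmetricAlgebra.lift ((TrivSqZeroExt.inlAlgHom R _ _).toLinearMap ∘ₗ SymmetricAlgebra.ι R M +
    (TrivSqZeroExt.inrHom (SymmetricAlgebra R M) _).restrictScalars R ∘ₗ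
      SymmetricAlgebra.ι R M ∘ₗ φ)

theorem fst_dualNumberLift (φ : M →ₗ[R] M) (f : SymmetricAlgebra R M) :
    (dualNumberLift φ f).fst = f := by
  have h : (TrivSqZeroExt.fstHom R _ _).comp (dualNumberLift φ) = AlgHom.id R _ := by
    ext x
    simp [dualNumberLift]
  exact congr($h f)

/-- The derivation of the symmetric algebra of `M` which extends the endomorphism `φ` of `M`. For
`φ = ad x` it is the Poisson bracket `{x, ·}` on the symmetric algebra of a Lie algebra. -/
noncomputable def symmetricDerivation (φ : M →ₗ[R] M) :
    Derivation R (SymmetricAlgebra R M) (SymmetricAlgebra R M) :=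
  Derivation.mk' ((TrivSqZeroExt.sndHom (SymmetricAlgebra R M) _).restrictScalars R ∘ₗ
    (dualNumberLift φ).toLinearMap) fun f g => by
      simp [TrivSqZeroExt.snd_mul, fst_dualNumberLift, mul_comm]

theorem symmetricDerivation_ι (φ : M →ₗ[R] M) (x : M) :
    symmetricDerivation φ (SymmetricAlgebra.ι R M x) = SymmetricAlgebra.ι R M (φ x) := by
  simp [symmetricDerivation, dualNumberLift]

theorem adjoin_symmetricAlgebra_ι_image {s : Set M} (hs : Submodule.span R s = ⊤) :
    Algebra.adjoin R (SymmetricAlgebra.ι R M '' s) = ⊤ := by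
  have hι : ∀ x, SymmetricAlgebra.ι R M x ∈ Algebra.adjoin R (SymmetricAlgebra.ι R M '' s) := by
    intro x
    refine Algebra.span_le_adjoin R _ ?_
    rw [Submodule.span_image, hs]
    exact Submodule.mem_map_of_mem trivial
  refine Algebra.eq_top_iff.2 fun f => ?_
  induction f using SymmetricAlgebra.induction with
  | algebraMap r => exact Subalgebra.algebraMap_mem _ r
  | ι x => exact hι x
  | mul f g hf hg => exact mul_mem hf hg
  | add f g hf hg => exact add_mem hf hg

end SymmetricDerivation

section OrderFiltration

open UniversalEnvelopingAlgebra Finset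

variable {R L : Type*} [CommRing R] [LieRing L] [LieAlgebra R L]

variable (R L) in
/-- The homogeneous part `Tⁿ(L)` of the tensor algebra. -/
abbrev tensorDegree (n : ℕ) : Submodule R (TensorAlgebra R L) :=
  LinearMap.range (TensorAlgebra.ι R : L →ₗ[R] TensorAlgebra R L) ^ n

theorem proj_mul_eq_sum_antidiagonal {A : Type*} [Semiring A] [Algebra R A]
    (𝒜 : ℕ → Submodule R A) [GradedAlgebra 𝒜] (n : ℕ) (a b : A) :
    GradedAlgebra.proj 𝒜 n (a * b) =
      ∑ ij ∈ antidiagonal n, GradedAlgebra.proj 𝒜 ij.1 a * GradedAlgebra.proj 𝒜 ij.2 b := by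
  simp only [GradedAlgebra.proj_apply, DirectSum.decompose_mul]
  exact DirectSum.coe_mul_apply_eq_sum_antidiagonal 𝒜 _ _ _

theorem orderLT_eq_iSup_map (n : ℕ) : orderLT R L n =
    ⨆ i : Fin n, (tensorDegree R L i).map (mkAlgHom R L).toLinearMap := by
  simp only [orderLT, Submodule.map_pow, LinearMap.range_comp]

theorem map_tensorDegree_le_orderLT {m n : ℕ} (h : m < n) :
    (tensorDegree R L m).map (mkAlgHom R L).toLinearMap ≤ orderLT R L n :=
  orderLT_eq_iSup_map (R := R) (L := L) n ▸
    le_iSup (fun i : Fin n => (tensorDegree R L i).map (mkAlgHom R L).toLinearMap) ⟨m, h⟩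

theorem orderLT_le_iff {n : ℕ} {V : Submodule R (UniversalEnvelopingAlgebra R L)} :
    orderLT R L n ≤ V ↔ ∀ m < n, (tensorDegree R L m).map (mkAlgHom R L).toLinearMap ≤ V := by
  rw [orderLT_eq_iSup_map, iSup_le_iff, Fin.forall_iff]

theorem orderLT_mono {m n : ℕ} (h : m ≤ n) : orderLT R L m ≤ orderLT R L n :=
  orderLT_le_iff.2 fun _ hi => map_tensorDegree_le_orderLT (hi.trans_le h)

theorem orderLT_zero : orderLT R L 0 = ⊥ :=
  le_bot_iff.1 (orderLT_le_iff.2 fun _ h => absurd h (Nat.not_lt_zero _))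

theorem orderLT_succ_le (n : ℕ) : orderLT R L (n + 1) ≤
    orderLT R L n ⊔ (tensorDegree R L n).map (mkAlgHom R L).toLinearMap := by
  refine orderLT_le_iff.2 fun m hm => ?_
  rcases (Nat.lt_succ_iff.1 hm).lt_or_eq with hlt | rfl
  · exact (map_tensorDegree_le_orderLT hlt).trans le_sup_left
  · exact le_sup_right

theorem map_tensorDegree_mul_orderLT_le (i j : ℕ) :
    (tensorDegree R L i).map (mkAlgHom R L).toLinearMap * orderLT R L j ≤
      orderLT R L (i + j) := by
  rw [orderLT_eq_iSup_map j, Submodule.mul_iSup]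
  refine iSup_le fun m => ?_
  rw [← Submodule.map_mul, ← pow_add]
  exact map_tensorDegree_le_orderLT (by lia)

theorem orderLT_mul_map_tensorDegree_le (i j : ℕ) :
    orderLT R L i * (tensorDegree R L j).map (mkAlgHom R L).toLinearMap ≤
      orderLT R L (i + j) := by
  rw [orderLT_eq_iSup_map i, Submodule.iSup_mul]
  refine iSup_le fun m => ?_
  rw [← Submodule.map_mul, ← pow_add]
  exact map_tensorDegree_le_orderLT (by lia)

theorem mkAlgHom_surjective : Function.Surjective (mkAlgHom R L) :=
  RingCon.mkₐ_surjective (α := R) _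

theorem exists_mem_orderLT (u : UniversalEnvelopingAlgebra R L) : ∃ n, u ∈ orderLT R L n := by
  classical
  rw [← Submodule.mem_iSup_of_directed _ (Monotone.directed_le fun _ _ => orderLT_mono)]
  obtain ⟨t, rfl⟩ := mkAlgHom_surjective u
  rw [← DirectSum.sum_support_decompose (tensorDegree R L) t, map_sum]
  exact sum_mem fun n _ => le_iSup (orderLT R L) (n + 1)
    (map_tensorDegree_le_orderLT n.lt_succ_self (Submodule.mem_map_of_mem (SetLike.coe_mem _)))

theorem mkAlgHom_ι_lie (x z : L) : mkAlgHom R L (TensorAlgebra.ι R ⁅x, z⁆) =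
    mkAlgHom R L (TensorAlgebra.ι R x) * mkAlgHom R L (TensorAlgebra.ι R z) -
      mkAlgHom R L (TensorAlgebra.ι R z) * mkAlgHom R L (TensorAlgebra.ι R x) :=
  letI : LieRing (UniversalEnvelopingAlgebra R L) := .ofAssociativeRing
  (UniversalEnvelopingAlgebra.ι R).map_lie x z

variable (J : TwoSidedIdeal (UniversalEnvelopingAlgebra R L))

/-- The space `J + U_{< n}`, which contains `u ∈ U_n` if and only if the class of `u` in
`U_n / U_{n - 1}` lies in the degree `n` part of `gr J`. -/
def supOrderLT (n : ℕ) : Submodule R (UniversalEnvelopingAlgebra R L) :=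
  J.asIdeal.restrictScalars R ⊔ orderLT R L n

variable {J}

theorem mem_supOrderLT {n : ℕ} {u : UniversalEnvelopingAlgebra R L} :
    u ∈ supOrderLT J n ↔ ∃ v ∈ J, u - v ∈ orderLT R L n := by
  rw [supOrderLT, Submodule.mem_sup]
  constructor
  · rintro ⟨v, hv, w, hw, rfl⟩
    exact ⟨v, TwoSidedIdeal.mem_asIdeal.1 hv, by simpa using hw⟩
  · rintro ⟨v, hv, hw⟩
    exact ⟨v, TwoSidedIdeal.mem_asIdeal.2 hv, _, hw, by simp⟩

theorem mul_mem_supOrderLT {i j : ℕ} {s : TensorAlgebra R L} {u : UniversalEnvelopingAlgebra R L}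
    (hs : s ∈ tensorDegree R L i) (hu : u ∈ supOrderLT J j) :
    mkAlgHom R L s * u ∈ supOrderLT J (i + j) := by
  obtain ⟨v, hv, huv⟩ := mem_supOrderLT.1 hu
  refine mem_supOrderLT.2 ⟨mkAlgHom R L s * v, J.mul_mem_left _ _ hv, ?_⟩
  rw [← mul_sub]
  exact map_tensorDegree_mul_orderLT_le i j
    (Submodule.mul_mem_mul (Submodule.mem_map_of_mem hs) huv)

theorem supOrderLT_mul_mem {i j : ℕ} {s : TensorAlgebra R L} {u : UniversalEnvelopingAlgebra R L}
    (hu : u ∈ supOrderLT J i) (hs : s ∈ tensorDegree R L j) :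
    u * mkAlgHom R L s ∈ supOrderLT J (i + j) := by
  obtain ⟨v, hv, huv⟩ := mem_supOrderLT.1 hu
  refine mem_supOrderLT.2 ⟨v * mkAlgHom R L s, J.mul_mem_right _ _ hv, ?_⟩
  rw [← sub_mul]
  exact orderLT_mul_map_tensorDegree_le i j
    (Submodule.mul_mem_mul huv (Submodule.mem_map_of_mem hs))

variable (J) in
/-- The preimage of `gr J` in the tensor algebra: the tensors all of whose homogeneous components
represent symbols of elements of `J`. -/
def tensorIdeal : TwoSidedIdeal (TensorAlgebra R L) :=
  .mk' {t | ∀ n, mkAlgHom R L (GradedAlgebra.proj (tensorDegree R L) n t) ∈ supOrderLT J n}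
    (fun n => by simp)
    (fun hs ht n => by simpa using add_mem (hs n) (ht n))
    (fun ht n => by rw [map_neg, map_neg]; exact neg_mem (ht n))
    (fun ht n => by
      rw [proj_mul_eq_sum_antidiagonal, map_sum]
      refine sum_mem fun ij hij => ?_
      rw [← mem_antidiagonal.1 hij, map_mul]
      exact mul_mem_supOrderLT (SetLike.coe_mem _) (ht _))
    (fun hs n => by
      rw [proj_mul_eq_sum_antidiagonal, map_sum]
      refine sum_mem fun ij hij => ?_
      rw [← mem_antidiagonal.1 hij, map_mul]
      exact supOrderLT_mul_mem (hs _) (SetLike.coe_mem _))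

theorem mem_tensorIdeal {t : TensorAlgebra R L} : t ∈ tensorIdeal J ↔
    ∀ n, mkAlgHom R L (GradedAlgebra.proj (tensorDegree R L) n t) ∈ supOrderLT J n :=
  TwoSidedIdeal.mem_mk' ..

theorem mem_tensorIdeal_iff_of_mem {n : ℕ} {t : TensorAlgebra R L} (ht : t ∈ tensorDegree R L n) :
    t ∈ tensorIdeal J ↔ mkAlgHom R L t ∈ supOrderLT J n := by
  have hproj : GradedAlgebra.proj (tensorDegree R L) n t = t :=
    DirectSum.decompose_of_mem_same (tensorDegree R L) ht
  refine ⟨fun h => hproj ▸ mem_tensorIdeal.1 h n, fun h => mem_tensorIdeal.2 fun m => ?_⟩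
  rcases eq_or_ne n m with rfl | hne
  · rwa [hproj]
  · have hzero : GradedAlgebra.proj (tensorDegree R L) m t = 0 :=
      DirectSum.decompose_of_mem_ne (tensorDegree R L) ht hne
    rw [hzero, map_zero]
    exact zero_mem _

theorem ι_mul_ι_mem_tensorDegree (x z : L) :
    TensorAlgebra.ι R x * TensorAlgebra.ι R z ∈ tensorDegree R L 2 := by
  rw [tensorDegree, sq]
  exact Submodule.mul_mem_mul ⟨x, rfl⟩ ⟨z, rfl⟩

theorem ι_mul_ι_sub_mem_tensorIdeal (x z : L) :
    TensorAlgebra.ι R x * TensorAlgebra.ι R z - TensorAlgebra.ι R z * TensorAlgebra.ι R x ∈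
      tensorIdeal J := by
  rw [mem_tensorIdeal_iff_of_mem
    (sub_mem (ι_mul_ι_mem_tensorDegree x z) (ι_mul_ι_mem_tensorDegree z x))]
  have hlie : mkAlgHom R L (TensorAlgebra.ι R ⁅x, z⁆) ∈ orderLT R L 2 :=
    map_tensorDegree_le_orderLT one_lt_two (Submodule.mem_map_of_mem (by simp))
  rw [map_sub, map_mul, map_mul, ← mkAlgHom_ι_lie]
  exact mem_supOrderLT.2 ⟨0, J.zero_mem, by simpa using hlie⟩

theorem sub_mem_tensorIdeal {s t : TensorAlgebra R L}
    (h : SymmetricAlgebra.algHom R L s = SymmetricAlgebra.algHom R L t) :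
    s - t ∈ tensorIdeal J := by
  have hle : TensorAlgebra.symRingCon R L ≤ (tensorIdeal J).ringCon := by
    refine RingCon.ringConGen_le.2 ?_
    rintro _ _ ⟨x, z⟩
    exact (TwoSidedIdeal.rel_iff _ _ _).2 (ι_mul_ι_sub_mem_tensorIdeal x z)
  exact (TwoSidedIdeal.rel_iff _ _ _).1 (hle ((RingCon.eq _).1 h))

theorem grIdeal_le_map_tensorIdeal :
    grIdeal J ≤ (tensorIdeal J).asIdeal.map (SymmetricAlgebra.algHom R L) := by
  refine Ideal.span_le.2 ?_
  rintro _ ⟨n, u, hu, t, ht, hut, rfl⟩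
  refine Ideal.mem_map_of_mem _ (TwoSidedIdeal.mem_asIdeal.2 ?_)
  exact (mem_tensorIdeal_iff_of_mem ht).2 (mem_supOrderLT.2 ⟨u, hu, sub_mem_comm_iff.1 hut⟩)

theorem mem_tensorIdeal_of_algHom_mem_grIdeal {t : TensorAlgebra R L}
    (h : SymmetricAlgebra.algHom R L t ∈ grIdeal J) : t ∈ tensorIdeal J := by
  obtain ⟨s, hs, hst⟩ := (Ideal.mem_map_iff_of_surjective _
    (SymmetricAlgebra.algHom_surjective R L)).1 (grIdeal_le_map_tensorIdeal h)
  simpa using (tensorIdeal J).add_mem (sub_mem_tensorIdeal hst.symm)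
    (TwoSidedIdeal.mem_asIdeal.1 hs)

theorem grIdeal_mono {I J : TwoSidedIdeal (UniversalEnvelopingAlgebra R L)} (h : I ≤ J) :
    grIdeal I ≤ grIdeal J :=
  Ideal.span_mono fun _ ⟨n, u, hu, hf⟩ => ⟨n, u, h hu, hf⟩

theorem eq_of_le_of_grIdeal_le {I J : TwoSidedIdeal (UniversalEnvelopingAlgebra R L)} (hle : I ≤ J)
    (hgr : grIdeal J ≤ grIdeal I) : I = J := by
  suffices h : ∀ n, ∀ u ∈ orderLT R L n, u ∈ J → u ∈ I from
    le_antisymm hle fun u hu => (exists_mem_orderLT u).elim fun n hn => h n u hn hu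
  intro n
  induction n with
  | zero =>
    intro u hn _
    rw [orderLT_zero, Submodule.mem_bot] at hn
    exact hn ▸ I.zero_mem
  | succ n ih =>
    intro u hn hu
    obtain ⟨w, hw, _, ⟨t, ht, rfl⟩, rfl⟩ := Submodule.mem_sup.1 (orderLT_succ_le n hn)
    have hsymbol : SymmetricAlgebra.algHom R L t ∈ grIdeal J :=
      Ideal.subset_span ⟨n, _, hu, t, ht, by simpa using hw, rfl⟩
    obtain ⟨v, hv, htv⟩ := mem_supOrderLT.1
      ((mem_tensorIdeal_iff_of_mem ht).1 (mem_tensorIdeal_of_algHom_mem_grIdeal (hgr hsymbol)))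
    have hdiff : w + mkAlgHom R L t - v ∈ orderLT R L n := add_sub_assoc w _ v ▸ add_mem hw htv
    simpa using I.add_mem (ih _ hdiff (J.sub_mem hu (hle hv))) hv

end OrderFiltration

section PoissonBracket

open UniversalEnvelopingAlgebra

variable {R L : Type*} [CommRing R] [LieRing L] [LieAlgebra R L]

variable (R) in
/-- The Poisson bracket `{x, ·}` on `S(L)` with an element `x` of `L`. -/
noncomputable abbrev poisson (x : L) :
    Derivation R (SymmetricAlgebra R L) (SymmetricAlgebra R L) :=
  symmetricDerivation (LieAlgebra.ad R L x : L →ₗ[R] L)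

theorem poisson_ι (x z : L) :
    poisson R x (SymmetricAlgebra.ι R L z) = SymmetricAlgebra.ι R L ⁅x, z⁆ :=
  symmetricDerivation_ι _ z

/-- The adjoint action of `x` on `U(L)` and the Poisson bracket with `x` on `S(L)` are induced by
the same map on homogeneous tensors. -/
theorem exists_tensor_commutator_poisson (x : L) {n : ℕ} {t : TensorAlgebra R L}
    (ht : t ∈ tensorDegree R L n) :
    ∃ s ∈ tensorDegree R L n,
      mkAlgHom R L s = ι R x * mkAlgHom R L t - mkAlgHom R L t * ι R x ∧
        SymmetricAlgebra.algHom R L s = poisson R x (SymmetricAlgebra.algHom R L t) := by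
  induction ht using Submodule.pow_induction_on_left' with
  | algebraMap r =>
    refine ⟨0, zero_mem _, ?_, ?_⟩
    · rw [map_zero, AlgHom.commutes, Algebra.commutes, sub_self]
    · rw [map_zero, AlgHom.commutes, Derivation.map_algebraMap]
  | add t₁ t₂ i _ _ h₁ h₂ =>
    obtain ⟨s₁, hs₁, hU₁, hS₁⟩ := h₁
    obtain ⟨s₂, hs₂, hU₂, hS₂⟩ := h₂
    refine ⟨s₁ + s₂, add_mem hs₁ hs₂, ?_, ?_⟩
    · rw [map_add, map_add, hU₁, hU₂]
      noncomm_ring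
    · rw [map_add, map_add, map_add, hS₁, hS₂]
  | mem_mul m hm i t ht h =>
    obtain ⟨z, rfl⟩ := hm
    obtain ⟨s, hs, hU, hS⟩ := h
    refine ⟨TensorAlgebra.ι R ⁅x, z⁆ * t + TensorAlgebra.ι R z * s, ?_, ?_, ?_⟩
    · rw [Nat.succ_eq_add_one, tensorDegree, pow_succ']
      exact add_mem (Submodule.mul_mem_mul ⟨_, rfl⟩ ht) (Submodule.mul_mem_mul ⟨_, rfl⟩ hs)
    · rw [map_add, map_mul, map_mul, map_mul, hU, mkAlgHom_ι_lie, ι_apply]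
      noncomm_ring
    · have hι (z : L) : SymmetricAlgebra.algHom R L (TensorAlgebra.ι R z) =
          SymmetricAlgebra.ι R L z := rfl
      rw [map_add, map_mul, map_mul, map_mul, hS, Derivation.leibniz, hι, hι, poisson_ι,
        smul_eq_mul, smul_eq_mul]
      ring

theorem commutator_mem_orderLT (x : L) {n : ℕ} {u : UniversalEnvelopingAlgebra R L}
    (hu : u ∈ orderLT R L n) : ι R x * u - u * ι R x ∈ orderLT R L n := by
  suffices orderLT R L n ≤
      (orderLT R L n).comap (LinearMap.mulLeft R (ι R x) - LinearMap.mulRight R (ι R x)) from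
    this hu
  refine orderLT_le_iff.2 fun m hm => Submodule.map_le_iff_le_comap.2 fun t ht => ?_
  obtain ⟨s, hs, hU, -⟩ := exists_tensor_commutator_poisson x ht
  have hs' : mkAlgHom R L s ∈ orderLT R L n :=
    map_tensorDegree_le_orderLT hm (Submodule.mem_map_of_mem hs)
  rwa [hU] at hs'

theorem poisson_mem_grIdeal {J : TwoSidedIdeal (UniversalEnvelopingAlgebra R L)} (x : L)
    {f : SymmetricAlgebra R L} (hf : f ∈ grIdeal J) : poisson R x f ∈ grIdeal J := by
  induction hf using Submodule.span_induction with
  | mem f hf =>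
    obtain ⟨n, u, hu, t, ht, hut, rfl⟩ := hf
    obtain ⟨s, hs, hU, hS⟩ := exists_tensor_commutator_poisson x ht
    refine Ideal.subset_span ⟨n, ι R x * u - u * ι R x, ?_, s, hs, ?_, hS⟩
    · exact J.sub_mem (J.mul_mem_left _ _ hu) (J.mul_mem_right _ _ hu)
    · convert commutator_mem_orderLT x hut using 1
      rw [hU]
      noncomm_ring
  | zero => simp
  | add f g _ _ hf hg => rw [map_add]; exact add_mem hf hg
  | smul a f hf' hf =>
    rw [smul_eq_mul, Derivation.leibniz]
    exact add_mem (Ideal.mul_mem_left _ _ hf) (Ideal.mul_mem_right _ _ hf')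

theorem wellFoundedGT_of_poisson (x : L) [WellFoundedGT (RadicalDifferentialIdeal (poisson R x))] :
    WellFoundedGT {J : TwoSidedIdeal (UniversalEnvelopingAlgebra R L) // (grIdeal J).IsRadical} :=
  let gr (J : {J : TwoSidedIdeal (UniversalEnvelopingAlgebra R L) // (grIdeal J).IsRadical}) :
      RadicalDifferentialIdeal (poisson R x) := ⟨grIdeal J.1, J.2, poisson_mem_grIdeal x⟩
  StrictMono.wellFoundedGT (f := gr) fun _ _ hIJ =>
    lt_of_le_not_ge (grIdeal_mono hIJ.le) fun h =>
      hIJ.ne (Subtype.ext (eq_of_le_of_grIdeal_le hIJ.le h))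

end PoissonBracket

namespace PositiveWitt

variable (k : Type*) [Field k]

/-- The polynomial ring `k[e 1]` inside `S(W₊)`. -/
noncomputable abbrev constants : Subalgebra k (SymmetricAlgebra k (PositiveWitt k)) :=
  Algebra.adjoin k {SymmetricAlgebra.ι k _ (e k 1)}

instance : IsNoetherianRing (constants k) :=
  isNoetherianRing_of_fg (Subalgebra.fg_def.2 ⟨_, Set.finite_singleton _, rfl⟩)

/-- The element `{e 1, {e 1, …, {e 1, e 2}}}` of `S(W₊)` with `n` Poisson brackets: as
`{e 1, e m} = (m - 1) e (m + 1)`, it is `n! e (n + 2)`. -/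
noncomputable def iteratedBracket (n : ℕ) : SymmetricAlgebra k (PositiveWitt k) :=
  (n.factorial : k) • SymmetricAlgebra.ι k _ (e k (n + 1).succPNat)

variable {k} [CharZero k]

theorem poisson_ι_e (n : ℕ+) : poisson k (e k 1) (SymmetricAlgebra.ι k _ (e k n)) =
    ((n : ℕ) - 1 : k) • SymmetricAlgebra.ι k _ (e k (n + 1)) := by
  rw [poisson_ι, lie_e_e, map_smul, add_comm, PNat.one_coe, Nat.cast_one]

theorem poisson_iteratedBracket (n : ℕ) :
    poisson k (e k 1) (iteratedBracket k n) = iteratedBracket k (n + 1) := by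
  rw [iteratedBracket, Derivation.map_smul, poisson_ι_e, smul_smul, iteratedBracket,
    Nat.factorial_succ, Nat.succPNat_coe]
  congr 1
  push_cast
  ring

theorem poisson_eq_zero_of_mem_constants {a : SymmetricAlgebra k (PositiveWitt k)}
    (ha : a ∈ constants k) : poisson k (e k 1) a = 0 := by
  refine Derivation.eqOn_adjoin (D2 := 0) ?_ ha
  rintro _ rfl
  simp [poisson_ι_e]

theorem adjoin_constants_range_iteratedBracket :
    Algebra.adjoin (constants k) (Set.range (iteratedBracket k)) = ⊤ := by
  let S := Algebra.adjoin k
    ({SymmetricAlgebra.ι k _ (e k 1)} ∪ Set.range (iteratedBracket k))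
  have he (n : ℕ) : SymmetricAlgebra.ι k _ (e k n.succPNat) ∈ S := by
    rcases n with _ | n
    · exact Algebra.subset_adjoin (Or.inl rfl)
    · have hn : iteratedBracket k n ∈ S := Algebra.subset_adjoin (Or.inr ⟨n, rfl⟩)
      have h := S.smul_mem hn (n.factorial : k)⁻¹
      rwa [iteratedBracket, inv_smul_smul₀ (Nat.cast_ne_zero.2 n.factorial_ne_zero)] at h
  have hS : S = ⊤ := by
    rw [← top_le_iff, ← adjoin_symmetricAlgebra_ι_image (basis k).span_eq]
    refine Algebra.adjoin_le ?_
    rintro _ ⟨_, ⟨n, rfl⟩, rfl⟩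
    exact n.succPNat_natPred ▸ he n.natPred
  refine Subalgebra.restrictScalars_injective k ?_
  rw [← Algebra.adjoin_union_eq_adjoin_adjoin, Subalgebra.restrictScalars_top]
  exact hS

variable (k) in
theorem wellFoundedGT_radicalDifferentialIdeal_poisson :
    WellFoundedGT (RadicalDifferentialIdeal (poisson k (e k 1))) := by
  let : Algebra ℚ (SymmetricAlgebra k (PositiveWitt k)) := Algebra.compHom _ (algebraMap ℚ k)
  refine RadicalDifferentialIdeal.wellFoundedGT_of_adjoin_range_eq_top
    (0 : Derivation k (constants k) (constants k)) (fun a => ?_) poisson_iteratedBracket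
    adjoin_constants_range_iteratedBracket
  exact poisson_eq_zero_of_mem_constants a.2

end PositiveWitt

theorem corollary2p14 (k : Type*) [Field k] [CharZero k]
    (J : ℕ → TwoSidedIdeal (UniversalEnvelopingAlgebra k (PositiveWitt k)))
    (hmono : Monotone J)
    (hrad : ∀ n, (UniversalEnvelopingAlgebra.grIdeal (J n)).IsRadical) :
    ∃ N, ∀ n, N ≤ n → J n = J N := by
  have := PositiveWitt.wellFoundedGT_radicalDifferentialIdeal_poisson k
  have := wellFoundedGT_of_poisson (R := k) (PositiveWitt.e k 1)
  let chain : ℕ →o {I : TwoSidedIdeal (UniversalEnvelopingAlgebra k (PositiveWitt k)) //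
      (UniversalEnvelopingAlgebra.grIdeal I).IsRadical} := ⟨fun n => ⟨J n, hrad n⟩, hmono⟩
  obtain ⟨N, hN⟩ := WellFoundedGT.monotone_chain_condition chain
  exact ⟨N, fun n hn => congrArg Subtype.val (hN n hn).symm⟩
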